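/- For a measurable map \(\phi:\mathbb R^3\to S^3\subset\mathbb R^4\) with weak first derivatives \(\partial_1\phi,\partial_2\phi,\partial_3\phi\in L^1_{\rm loc}(\mathbb R^3,\mathbb R^4)\), let \[ \mathcal E(\phi)=\int_{\mathbb R^3}\Big(\sum_{i=1}^3|\partial_i\phi|^2+\sum_{1\le i<j\le 3}|\partial_i\phi\wedge\partial_j\phi|^2\Big)\,dx\in[0,\infty], \] where \(|v\wedge w|^2=\sum_{1\le a<b\le 4}(v_aw_b-v_bw_a)^2\) for \(v,w\in\mathbb R^4\). Let \(X\) be the set of all such maps with \(\mathcal E(\phi)<\infty\), and for \(\phi\in X\) let \[ d(\phi)=\frac1{2\pi^2}\int_{\mathbb R^3}\det(\phi,\partial_1\phi,\partial_2\phi,\partial_3\phi)\,dx \] be its degree. For \(k\in\mathbb Z\) put \(I_k=\inf\{\mathcal E(\phi):\phi\in X,\ d(\phi)=k\}\) (with \(\inf\emptyset=+\infty\)). Then for every integer \(k\), \[ 12\,|k|\,\pi^2\;\le\; I_k\;\le\;12\sqrt2\,|k|\,\pi^2 . \] -/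

import Mathlib

open MeasureTheory
open scoped ENNReal ContDiff

noncomputable section

namespace Skyrme

/-- The Euclidean space `ℝ³`. -/
abbrev E3 : Type := EuclideanSpace ℝ (Fin 3)

/-- The Euclidean space `ℝ⁴`. -/
abbrev E4 : Type := EuclideanSpace ℝ (Fin 4)

/-- The unit sphere `S³` of `ℝ⁴`. -/
abbrev S3 : Type := Metric.sphere (0 : E4) 1

/-- `g` is a weak (distributional) `i`-th partial derivative of `u : ℝ³ → ℝ⁴`: both functions are
locally integrable, and `∫ (∂ᵢψ) u = - ∫ ψ g` for every test function `ψ ∈ C_c^∞(ℝ³)`. -/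
def IsWeakPartial (i : Fin 3) (u g : E3 → E4) : Prop :=
  LocallyIntegrable u volume ∧ LocallyIntegrable g volume ∧
    ∀ ψ : E3 → ℝ, ContDiff ℝ ∞ ψ → HasCompactSupport ψ →
      ∫ x, (fderiv ℝ ψ x (EuclideanSpace.single i 1)) • u x = - ∫ x, ψ x • g x

/-- Weak partial derivatives are unique up to a null set. -/
theorem IsWeakPartial.ae_eq {i : Fin 3} {u g h : E3 → E4}
    (hg : IsWeakPartial i u g) (hh : IsWeakPartial i u h) : g =ᵐ[volume] h := by
  refine ae_eq_of_integral_contDiff_smul_eq hg.2.1 hh.2.1 fun ψ hψ hc => ?_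
  have h1 := hg.2.2 ψ hψ hc
  have h2 := hh.2.2 ψ hψ hc
  exact neg_injective (h1.symm.trans h2)

open Classical in
/-- The weak partial derivative `∂ᵢu` of `u : ℝ³ → ℝ⁴` (well defined up to a null set; the zero
function if `u` has no weak `i`-th partial derivative). -/
def weakPartial (i : Fin 3) (u : E3 → E4) : E3 → E4 :=
  if h : ∃ g, IsWeakPartial i u g then h.choose else 0

theorem isWeakPartial_weakPartial {i : Fin 3} {u : E3 → E4} (h : ∃ g, IsWeakPartial i u g) :
    IsWeakPartial i u (weakPartial i u) := by
  rw [weakPartial, dif_pos h]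
  exact h.choose_spec

theorem IsWeakPartial.weakPartial_ae_eq {i : Fin 3} {u g : E3 → E4} (h : IsWeakPartial i u g) :
    weakPartial i u =ᵐ[volume] g :=
  (isWeakPartial_weakPartial ⟨g, h⟩).ae_eq h

/-- The weak partial derivative `∂ᵢφ : ℝ³ → ℝ⁴` of a map `φ : ℝ³ → S³ ⊂ ℝ⁴`. -/
def partialD (φ : E3 → S3) (i : Fin 3) : E3 → E4 :=
  weakPartial i fun x => (φ x : E4)

/-- The squared norm `|v ∧ w|²` of the exterior product of `v, w ∈ ℝ⁴` in `Λ²ℝ⁴`, the products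
`e_a ∧ e_b`, `a < b`, of the standard basis vectors being orthonormal: the coordinate of `v ∧ w`
on `e_a ∧ e_b` is `v_a w_b - v_b w_a`. -/
def wedgeNormSq (v w : E4) : ℝ :=
  ∑ a : Fin 4, ∑ b ∈ Finset.Ioi a, (v a * w b - v b * w a) ^ 2

/-- The energy density `|∇φ|² + |A(φ)|²`, where `|∇φ|² = ∑ᵢ |∂ᵢφ|²` and
`|A(φ)|² = ∑_{i<j} |∂ᵢφ ∧ ∂ⱼφ|²`. -/
def energyDensity (φ : E3 → S3) (x : E3) : ℝ :=
  ∑ i : Fin 3, ‖partialD φ i x‖ ^ 2 +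
    ∑ i : Fin 3, ∑ j ∈ Finset.Ioi i, wedgeNormSq (partialD φ i x) (partialD φ j x)

/-- The Skyrme energy `∫ |∇φ|² + |A(φ)|² dx`, with values in `[0, ∞]`. -/
def energy (φ : E3 → S3) : ℝ≥0∞ :=
  ∫⁻ x, ENNReal.ofReal (energyDensity φ x)

/-- The space `X` of the measurable maps `φ : ℝ³ → S³` that have weak first derivatives and finite
Skyrme energy. -/
def X : Set (E3 → S3) :=
  {φ | AEMeasurable φ volume ∧ (∀ i : Fin 3, ∃ g, IsWeakPartial i (fun x => (φ x : E4)) g) ∧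
    energy φ < ⊤}

/-- `det(φ, ∇φ)`: the determinant of the `4 × 4` matrix with rows `φ, ∂₁φ, ∂₂φ, ∂₃φ`. -/
def jacobian (φ : E3 → S3) (x : E3) : ℝ :=
  Matrix.det (Matrix.of ![fun a => (φ x : E4) a, fun a => partialD φ 0 x a,
    fun a => partialD φ 1 x a, fun a => partialD φ 2 x a])

/-- The degree `d(φ) = (1 / 2π²) ∫ det(φ, ∇φ) dx`. The integrand is integrable if `φ ∈ X`. -/
def degree (φ : E3 → S3) : ℝ :=
  1 / (2 * Real.pi ^ 2) * ∫ x, jacobian φ x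

/-- `I_k`, the infimum of the Skyrme energy over the maps in `X` of degree `k`, taken in `[0, ∞]`
(it is `∞` if there are no such maps). -/
def minEnergy (k : ℤ) : ℝ≥0∞ :=
  ⨅ φ ∈ {φ : E3 → S3 | φ ∈ X ∧ degree φ = (k : ℝ)}, energy φ

end Skyrme

end

/-! Lower bound: at each point, det(u, p₀, p₁, p₂) with u a unit vector is the scalar product of p₀
with a vector of norm at most |p₁ ∧ p₂|, so 2|det| ≤ |p₀|² + |p₁ ∧ p₂|². Summing over the three
cyclic permutations of the derivatives gives 6|det| ≤ energy density (`six_mul_abs_gradDet_le`), and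
integrating gives 12π²|d| ≤ energy (`energy_ge`).

Upper bound: inverse stereographic projection from the sphere, with scale q, stretches every
direction by a = 2q/(q² + |x|²), so its energy is ∫ 3a² + 3a⁴ = 12π²|q| + 6π²/|q|. The minimum, at
q² = 1/2, is 12√2 π². Replacing q by a cutoff function of |x|² makes the map constant near infinity
without changing its degree ±1, and dominated convergence makes the extra energy arbitrarily small
(`exists_isCompactMap`). Maps that equal the pole off a compact set can be translated apart and
glued, which adds degrees and energies (`IsCompactMap.exists_add`); |k| copies of degree sign(k)
give the bound. -/

noncomputable section

namespace Skyrme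

/-! ### Pointwise algebra and the topological lower bound -/

/-- The energy density as a function of the three partial derivatives. -/
def gradEnergy (p : Fin 3 → E4) : ℝ :=
  ∑ i : Fin 3, ‖p i‖ ^ 2 + ∑ i : Fin 3, ∑ j ∈ Finset.Ioi i, wedgeNormSq (p i) (p j)

/-- The determinant with rows `u, p 0, p 1, p 2`. -/
def gradDet (u : E4) (p : Fin 3 → E4) : ℝ :=
  Matrix.det (Matrix.of ![fun a => u a, fun a => p 0 a, fun a => p 1 a, fun a => p 2 a])

theorem energyDensity_eq (φ : E3 → S3) (x : E3) :
    energyDensity φ x = gradEnergy fun i => partialD φ i x := rfl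

theorem jacobian_eq (φ : E3 → S3) (x : E3) :
    jacobian φ x = gradDet (φ x) fun i => partialD φ i x := rfl

theorem wedgeNormSq_eq (v w : E4) : wedgeNormSq v w =
    (v 0 * w 1 - v 1 * w 0) ^ 2 + (v 0 * w 2 - v 2 * w 0) ^ 2 + (v 0 * w 3 - v 3 * w 0) ^ 2 +
    (v 1 * w 2 - v 2 * w 1) ^ 2 + (v 1 * w 3 - v 3 * w 1) ^ 2 + (v 2 * w 3 - v 3 * w 2) ^ 2 := by
  have h0 : Finset.Ioi (0 : Fin 4) = {1, 2, 3} := by decide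
  have h1 : Finset.Ioi (1 : Fin 4) = {2, 3} := by decide
  have h2 : Finset.Ioi (2 : Fin 4) = {3} := by decide
  have h3 : Finset.Ioi (3 : Fin 4) = ∅ := by decide
  simp [wedgeNormSq, Fin.sum_univ_four, h0, h1, h2, h3]
  ring

theorem gradEnergy_eq (p : Fin 3 → E4) : gradEnergy p =
    ‖p 0‖ ^ 2 + ‖p 1‖ ^ 2 + ‖p 2‖ ^ 2 +
      (wedgeNormSq (p 0) (p 1) + wedgeNormSq (p 0) (p 2) + wedgeNormSq (p 1) (p 2)) := by
  have h0 : Finset.Ioi (0 : Fin 3) = {1, 2} := by decide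
  have h1 : Finset.Ioi (1 : Fin 3) = {2} := by decide
  have h2 : Finset.Ioi (2 : Fin 3) = ∅ := by decide
  simp [gradEnergy, Fin.sum_univ_three, h0, h1, h2]

theorem gradEnergy_nonneg (p : Fin 3 → E4) : 0 ≤ gradEnergy p := by
  unfold gradEnergy wedgeNormSq
  positivity

theorem norm_sq_E4 (v : E4) : ‖v‖ ^ 2 = v 0 ^ 2 + v 1 ^ 2 + v 2 ^ 2 + v 3 ^ 2 := by
  simp [EuclideanSpace.norm_sq_eq, Fin.sum_univ_four]

theorem gradDet_eq (u : E4) (p : Fin 3 → E4) : gradDet u p =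
    (u 0 * p 0 1 - u 1 * p 0 0) * (p 1 2 * p 2 3 - p 1 3 * p 2 2) -
    (u 0 * p 0 2 - u 2 * p 0 0) * (p 1 1 * p 2 3 - p 1 3 * p 2 1) +
    (u 0 * p 0 3 - u 3 * p 0 0) * (p 1 1 * p 2 2 - p 1 2 * p 2 1) +
    (u 1 * p 0 2 - u 2 * p 0 1) * (p 1 0 * p 2 3 - p 1 3 * p 2 0) -
    (u 1 * p 0 3 - u 3 * p 0 1) * (p 1 0 * p 2 2 - p 1 2 * p 2 0) +
    (u 2 * p 0 3 - u 3 * p 0 2) * (p 1 0 * p 2 1 - p 1 1 * p 2 0) := by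
  simp [gradDet, Matrix.det_succ_row_zero, Fin.sum_univ_succ, Fin.succAbove, Matrix.submatrix]
  ring

/-- The determinant is bounded by half of the squared norm of one row and of the wedge product
of two others, if the remaining one is a unit vector. -/
theorem two_mul_abs_gradDet_le {u : E4} (hu : ‖u‖ = 1) (p : Fin 3 → E4) :
    2 * |gradDet u p| ≤ ‖p 0‖ ^ 2 + wedgeNormSq (p 1) (p 2) := by
  have h1 : u 0 ^ 2 + u 1 ^ 2 + u 2 ^ 2 + u 3 ^ 2 = 1 := by rw [← norm_sq_E4, hu, one_pow]
  set v := p 1 with hv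
  set w := p 2 with hw
  set a := v 0 * w 1 - v 1 * w 0 with ha
  set b := v 0 * w 2 - v 2 * w 0 with hb
  set c := v 0 * w 3 - v 3 * w 0 with hc
  set d := v 1 * w 2 - v 2 * w 1 with hd
  set e := v 1 * w 3 - v 3 * w 1 with he
  set f := v 2 * w 3 - v 3 * w 2 with hf
  have hpl : a * f - b * e + c * d = 0 := by rw [ha, hb, hc, hd, he, hf]; ring
  have hD : gradDet u p = (u 0 * p 0 1 - u 1 * p 0 0) * f - (u 0 * p 0 2 - u 2 * p 0 0) * e +
      (u 0 * p 0 3 - u 3 * p 0 0) * d + (u 1 * p 0 2 - u 2 * p 0 1) * c -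
      (u 1 * p 0 3 - u 3 * p 0 1) * b + (u 2 * p 0 3 - u 3 * p 0 2) * a := by
    rw [gradDet_eq]
  -- The cᵢ are the coefficients of the determinant as a linear form in the row p 0, that is, the
  -- Hodge dual of u ∧ v ∧ w up to sign.
  set c0 := -(u 1 * f) + u 2 * e - u 3 * d with hc0
  set c1 := u 0 * f - u 2 * c + u 3 * b with hc1
  set c2 := -(u 0 * e) + u 1 * c - u 3 * a with hc2
  set c3 := u 0 * d - u 1 * b + u 2 * a with hc3
  have hD' : gradDet u p = p 0 0 * c0 + p 0 1 * c1 + p 0 2 * c2 + p 0 3 * c3 := by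
    rw [hD, hc0, hc1, hc2, hc3]; ring
  -- With ω = v ∧ w this is |u ∧ ω|² + |ι_u ω|² = |u|² |ω|², where ι_u is contraction with u.
  have key : c0 ^ 2 + c1 ^ 2 + c2 ^ 2 + c3 ^ 2 +
      ((u 1 * a + u 2 * b + u 3 * c) ^ 2 + (-(u 0 * a) + u 2 * d + u 3 * e) ^ 2 +
        (-(u 0 * b) - u 1 * d + u 3 * f) ^ 2 + (-(u 0 * c) - u 1 * e - u 2 * f) ^ 2) =
      (u 0 ^ 2 + u 1 ^ 2 + u 2 ^ 2 + u 3 ^ 2) *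
        (a ^ 2 + b ^ 2 + c ^ 2 + d ^ 2 + e ^ 2 + f ^ 2) := by
    rw [hc0, hc1, hc2, hc3]; ring
  rw [h1, one_mul] at key
  have hwedge : wedgeNormSq v w = a ^ 2 + b ^ 2 + c ^ 2 + d ^ 2 + e ^ 2 + f ^ 2 :=
    wedgeNormSq_eq v w
  have hpos : c0 ^ 2 + c1 ^ 2 + c2 ^ 2 + c3 ^ 2 ≤ wedgeNormSq v w := by
    rw [hwedge, ← key]
    have := sq_nonneg (u 1 * a + u 2 * b + u 3 * c)
    have := sq_nonneg (-(u 0 * a) + u 2 * d + u 3 * e)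
    have := sq_nonneg (-(u 0 * b) - u 1 * d + u 3 * f)
    have := sq_nonneg (-(u 0 * c) - u 1 * e - u 2 * f)
    linarith
  rw [norm_sq_E4, hD']
  clear_value a b c d e f c0 c1 c2 c3
  rcases abs_cases (p 0 0 * c0 + p 0 1 * c1 + p 0 2 * c2 + p 0 3 * c3) with h | h <;> rw [h.1]
  · linarith [sq_nonneg (p 0 0 - c0), sq_nonneg (p 0 1 - c1), sq_nonneg (p 0 2 - c2),
      sq_nonneg (p 0 3 - c3)]
  · linarith [sq_nonneg (p 0 0 + c0), sq_nonneg (p 0 1 + c1), sq_nonneg (p 0 2 + c2),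
      sq_nonneg (p 0 3 + c3)]

theorem gradDet_cycle (u : E4) (p : Fin 3 → E4) : gradDet u ![p 1, p 2, p 0] = gradDet u p := by
  simp only [gradDet_eq, Matrix.cons_val]
  ring

theorem wedgeNormSq_comm (v w : E4) : wedgeNormSq v w = wedgeNormSq w v := by
  rw [wedgeNormSq_eq, wedgeNormSq_eq]
  ring

/-- A cyclic permutation of the last three rows is even and keeps the determinant. Over the three
cyclic versions of `two_mul_abs_gradDet_le`, each squared derivative and each wedge product occurs
exactly once on the right. -/
theorem six_mul_abs_gradDet_le {u : E4} (hu : ‖u‖ = 1) (p : Fin 3 → E4) :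
    6 * |gradDet u p| ≤ gradEnergy p := by
  have h0 := two_mul_abs_gradDet_le hu p
  have h1 := two_mul_abs_gradDet_le hu ![p 1, p 2, p 0]
  have h2 := two_mul_abs_gradDet_le hu ![p 2, p 0, p 1]
  have e2 : gradDet u ![p 2, p 0, p 1] = gradDet u p := by
    rw [← gradDet_cycle u p]
    exact gradDet_cycle u ![p 1, p 2, p 0]
  rw [gradDet_cycle] at h1
  rw [e2] at h2
  simp only [Matrix.cons_val] at h1 h2
  rw [gradEnergy_eq, wedgeNormSq_comm (p 0) (p 2)]
  linarith

/-- The topological lower bound for the energy. -/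
theorem energy_ge (φ : E3 → S3) :
    ENNReal.ofReal (12 * |degree φ| * Real.pi ^ 2) ≤ energy φ := by
  have hpi := Real.pi_pos
  have h : 12 * |degree φ| * Real.pi ^ 2 = 6 * ‖∫ x, jacobian φ x‖ := by
    rw [degree, abs_mul, abs_of_pos (by positivity : 0 < 1 / (2 * Real.pi ^ 2)), Real.norm_eq_abs]
    field_simp
    ring
  rw [h, ENNReal.ofReal_mul (by norm_num), ofReal_norm]
  calc ENNReal.ofReal 6 * ‖∫ x, jacobian φ x‖ₑ
      ≤ ENNReal.ofReal 6 * ∫⁻ x, ‖jacobian φ x‖ₑ := by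
        gcongr
        -- No integrability is needed: the integral is 0 by convention when the jacobian is not
        -- integrable.
        exact enorm_integral_le_lintegral_enorm _
    _ = ∫⁻ x, ENNReal.ofReal 6 * ‖jacobian φ x‖ₑ := by
        rw [lintegral_const_mul' _ _ ENNReal.ofReal_ne_top]
    _ ≤ energy φ := by
        refine lintegral_mono fun x => ?_
        rw [← ofReal_norm, ← ENNReal.ofReal_mul (by norm_num), Real.norm_eq_abs]
        refine ENNReal.ofReal_le_ofReal ?_
        rw [jacobian_eq, energyDensity_eq]
        exact six_mul_abs_gradDet_le (by simp) _

/-! ### C¹ maps that are constant near infinity -/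

/-- The classical `i`-th partial derivative. -/
def grad (F : E3 → E4) (x : E3) (i : Fin 3) : E4 :=
  fderiv ℝ F x (EuclideanSpace.single i 1)

/-- The last standard basis vector of `ℝ⁴`. -/
def pole : E4 := EuclideanSpace.single 3 1

theorem continuous_grad {F : E3 → E4} (hF : ContDiff ℝ 1 F) (i : Fin 3) :
    Continuous fun x => grad F x i :=
  (hF.continuous_fderiv one_ne_zero).clm_apply continuous_const

theorem isWeakPartial_grad {F : E3 → E4} (hF : ContDiff ℝ 1 F) (i : Fin 3) :
    IsWeakPartial i F fun x => grad F x i := by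
  refine ⟨hF.continuous.locallyIntegrable, (continuous_grad hF i).locallyIntegrable,
    fun ψ hψ hc => ?_⟩
  have hd : Continuous fun x => fderiv ℝ ψ x (EuclideanSpace.single i 1) :=
    (hψ.continuous_fderiv (by simp)).clm_apply continuous_const
  have hdc : HasCompactSupport fun x => fderiv ℝ ψ x (EuclideanSpace.single i 1) :=
    hc.fderiv_apply ℝ _
  rw [eq_neg_iff_add_eq_zero, add_comm, ← eq_neg_iff_add_eq_zero]
  refine integral_smul_fderiv_eq_neg_fderiv_smul_of_integrable ?_ ?_ ?_
    (fun x _ => hψ.differentiable (by simp) x) (fun x _ => hF.differentiable one_ne_zero x)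
  · exact (hd.smul hF.continuous).integrable_of_hasCompactSupport hdc.smul_right
  · exact (hψ.continuous.smul (continuous_grad hF i)).integrable_of_hasCompactSupport hc.smul_right
  · exact (hψ.continuous.smul hF.continuous).integrable_of_hasCompactSupport hc.smul_right

/-- `F` is a `C¹` map into the unit sphere which is constant outside a compact set, with total
determinant `D` and energy `E`. -/
structure IsCompactMap (F : E3 → E4) (D E : ℝ) : Prop where
  contDiff : ContDiff ℝ 1 F
  norm_eq : ∀ x, ‖F x‖ = 1
  hasCompactSupport : HasCompactSupport fun x => F x - pole
  integral_det : ∫ x, gradDet (F x) (grad F x) = D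
  integral_energy : ∫ x, gradEnergy (grad F x) = E

theorem continuous_gradEnergy {F : E3 → E4} (hF : ContDiff ℝ 1 F) :
    Continuous fun x => gradEnergy (grad F x) := by
  have h := continuous_grad hF
  have h' : ∀ i a, Continuous fun x => (grad F x i) a := fun i a => by
    have := h i
    fun_prop
  simp only [gradEnergy_eq, wedgeNormSq_eq, norm_sq_E4]
  fun_prop

theorem continuous_gradDet {F : E3 → E4} (hF : ContDiff ℝ 1 F) :
    Continuous fun x => gradDet (F x) (grad F x) := by
  have h := continuous_grad hF
  have h' : ∀ i a, Continuous fun x => (grad F x i) a := fun i a => by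
    have := h i
    fun_prop
  have h0 : ∀ a, Continuous fun x => (F x) a := fun a => by
    have := hF.continuous
    fun_prop
  simp only [gradDet_eq]
  fun_prop

theorem grad_congr {F G : E3 → E4} {x : E3} (h : F =ᶠ[nhds x] G) : grad F x = grad G x := by
  unfold grad
  rw [h.fderiv_eq]

theorem grad_const (c : E4) (x : E3) : grad (fun _ => c) x = 0 := by
  ext i
  simp [grad]

theorem gradEnergy_zero : gradEnergy 0 = 0 := by
  simp [gradEnergy, wedgeNormSq]

theorem gradDet_zero (u : E4) : gradDet u 0 = 0 := by
  simp [gradDet_eq]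

theorem eventuallyEq_pole {F : E3 → E4} {x : E3} (hx : x ∉ tsupport fun x => F x - pole) :
    F =ᶠ[nhds x] fun _ => pole := by
  rw [notMem_tsupport_iff_eventuallyEq] at hx
  filter_upwards [hx] with y hy using sub_eq_zero.1 hy

theorem hasCompactSupport_gradEnergy {F : E3 → E4}
    (h : HasCompactSupport fun x => F x - pole) :
    HasCompactSupport fun x => gradEnergy (grad F x) := by
  refine HasCompactSupport.intro h fun x hx => ?_
  simp only [grad_congr (eventuallyEq_pole hx), grad_const, gradEnergy_zero]

theorem hasCompactSupport_gradDet {F : E3 → E4}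
    (h : HasCompactSupport fun x => F x - pole) :
    HasCompactSupport fun x => gradDet (F x) (grad F x) := by
  refine HasCompactSupport.intro h fun x hx => ?_
  simp only [grad_congr (eventuallyEq_pole hx), grad_const, gradDet_zero]

theorem IsCompactMap.integrable_energy {F : E3 → E4} {D E : ℝ} (h : IsCompactMap F D E) :
    Integrable fun x => gradEnergy (grad F x) :=
  (continuous_gradEnergy h.contDiff).integrable_of_hasCompactSupport
    (hasCompactSupport_gradEnergy h.hasCompactSupport)

theorem IsCompactMap.integrable_det {F : E3 → E4} {D E : ℝ} (h : IsCompactMap F D E) :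
    Integrable fun x => gradDet (F x) (grad F x) :=
  (continuous_gradDet h.contDiff).integrable_of_hasCompactSupport
    (hasCompactSupport_gradDet h.hasCompactSupport)

/-- A `C¹` map that is constant outside a compact set belongs to `X`. -/
theorem IsCompactMap.exists_mem_X {F : E3 → E4} {D E : ℝ} (h : IsCompactMap F D E) :
    ∃ φ ∈ X, degree φ = 1 / (2 * Real.pi ^ 2) * D ∧ energy φ = ENNReal.ofReal E := by
  let φ : E3 → S3 := fun x => ⟨F x, by simpa using h.norm_eq x⟩
  have hw : ∀ i, IsWeakPartial i (fun x => (φ x : E4)) fun x => grad F x i :=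
    isWeakPartial_grad h.contDiff
  -- `partialD` is an arbitrarily chosen weak derivative, so it agrees with the classical one only
  -- almost everywhere; this suffices under the integrals.
  have hae : ∀ᵐ x, (fun i => partialD φ i x) = grad F x := by
    have := ae_all_iff.2 fun i => (hw i).weakPartial_ae_eq
    filter_upwards [this] with x hx
    exact funext hx
  have hE : energy φ = ENNReal.ofReal E := by
    rw [← h.integral_energy, ofReal_integral_eq_lintegral_ofReal h.integrable_energy
      (Filter.Eventually.of_forall fun x => gradEnergy_nonneg _)]
    refine lintegral_congr_ae ?_
    filter_upwards [hae] with x hx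
    rw [energyDensity_eq, hx]
  have hφ : Continuous φ := h.contDiff.continuous.subtype_mk _
  refine ⟨φ, ⟨hφ.aemeasurable, fun i => ⟨_, hw i⟩, hE ▸ ENNReal.ofReal_lt_top⟩, ?_, hE⟩
  rw [degree, ← h.integral_det]
  congr 1
  refine integral_congr_ae ?_
  filter_upwards [hae] with x hx
  rw [jacobian_eq, hx]

theorem isCompactMap_const : IsCompactMap (fun _ => pole) 0 0 where
  contDiff := contDiff_const
  norm_eq _ := by simp [pole]
  hasCompactSupport := by
    simp only [sub_self]
    exact HasCompactSupport.zero
  integral_det := by simp [grad_const, gradDet_zero]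
  integral_energy := by simp [grad_const, gradEnergy_zero]

/-! ### Translation, gluing and multiples -/

theorem grad_comp_sub (F : E3 → E4) (v x : E3) : grad (fun y => F (y - v)) x = grad F (x - v) := by
  ext1 i
  rw [grad, fderiv_comp_sub, grad]

theorem IsCompactMap.translate {F : E3 → E4} {D E : ℝ} (h : IsCompactMap F D E) (v : E3) :
    IsCompactMap (fun x => F (x - v)) D E where
  contDiff := h.contDiff.comp (contDiff_id.sub contDiff_const)
  norm_eq _ := h.norm_eq _
  hasCompactSupport := h.hasCompactSupport.comp_homeomorph (Homeomorph.subRight v)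
  integral_det := by
    simp only [grad_comp_sub]
    rw [integral_sub_right_eq_self fun x => gradDet (F x) (grad F x)]
    exact h.integral_det
  integral_energy := by
    simp only [grad_comp_sub]
    rw [integral_sub_right_eq_self fun x => gradEnergy (grad F x)]
    exact h.integral_energy

/-- Two maps with disjoint supports can be glued. -/
theorem IsCompactMap.glue {F G : E3 → E4} {D E D' E' : ℝ} (hF : IsCompactMap F D E)
    (hG : IsCompactMap G D' E')
    (hd : Disjoint (tsupport fun x => F x - pole) (tsupport fun x => G x - pole)) :
    IsCompactMap (fun x => F x + (G x - pole)) (D + D') (E + E') := by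
  -- The supports are closed and disjoint, so near any point one of the two maps is identically the
  -- pole and the glued map is the other. All the claims are local and follow from this alternative.
  have key : ∀ x, ((fun x => F x + (G x - pole)) =ᶠ[nhds x] F ∧ G =ᶠ[nhds x] fun _ => pole) ∨
      ((fun x => F x + (G x - pole)) =ᶠ[nhds x] G ∧ F =ᶠ[nhds x] fun _ => pole) := by
    intro x
    by_cases hx : x ∈ tsupport fun x => F x - pole
    · have h := eventuallyEq_pole (Set.disjoint_left.1 hd hx)
      refine Or.inl ⟨?_, h⟩
      filter_upwards [h] with y hy
      simp [hy]
    · have h := eventuallyEq_pole hx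
      refine Or.inr ⟨?_, h⟩
      filter_upwards [h] with y hy
      simp [hy]
  refine ⟨hF.contDiff.add (hG.contDiff.sub contDiff_const), fun x => ?_, ?_, ?_, ?_⟩
  · rcases key x with h | h
    · rw [h.1.eq_of_nhds, hF.norm_eq x]
    · rw [h.1.eq_of_nhds, hG.norm_eq x]
  · have : (fun x => F x + (G x - pole) - pole) =
        (fun x => F x - pole) + fun x => G x - pole := by
      ext1 x
      simp only [Pi.add_apply]
      abel
    rw [this]
    exact hF.hasCompactSupport.add hG.hasCompactSupport
  · rw [← hF.integral_det, ← hG.integral_det, ← integral_add hF.integrable_det hG.integrable_det]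
    congr 1
    ext1 x
    rcases key x with h | h
    · rw [grad_congr h.1, h.1.eq_of_nhds, grad_congr h.2, grad_const, gradDet_zero, add_zero]
    · rw [grad_congr h.1, h.1.eq_of_nhds, grad_congr h.2, grad_const, gradDet_zero, zero_add]
  · rw [← hF.integral_energy, ← hG.integral_energy,
      ← integral_add hF.integrable_energy hG.integrable_energy]
    congr 1
    ext1 x
    rcases key x with h | h
    · rw [grad_congr h.1, grad_congr h.2, grad_const, gradEnergy_zero, add_zero]
    · rw [grad_congr h.1, grad_congr h.2, grad_const, gradEnergy_zero, zero_add]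

/-- The difference set K - L is compact, hence not all of ℝ³; any v outside it works. -/
theorem exists_disjoint_translate {K L : Set E3} (hK : IsCompact K) (hL : IsCompact L) :
    ∃ v : E3, ∀ x ∈ K, x - v ∉ L := by
  have hc : IsCompact ((fun p : E3 × E3 => p.1 - p.2) '' K ×ˢ L) :=
    (hK.prod hL).image (by fun_prop)
  obtain ⟨v, hv⟩ := (Set.ne_univ_iff_exists_notMem _).1 hc.ne_univ
  exact ⟨v, fun x hx hxL => hv ⟨(x, x - v), ⟨hx, hxL⟩, by simp⟩⟩

theorem IsCompactMap.exists_add {F G : E3 → E4} {D E D' E' : ℝ} (hF : IsCompactMap F D E)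
    (hG : IsCompactMap G D' E') : ∃ H, IsCompactMap H (D + D') (E + E') := by
  obtain ⟨v, hv⟩ := exists_disjoint_translate hF.hasCompactSupport hG.hasCompactSupport
  refine ⟨_, hF.glue (hG.translate v) (Set.disjoint_left.2 fun x hx hx' => hv x hx ?_)⟩
  have := tsupport_comp_subset_preimage (fun x => G x - pole) (f := fun x => x - v)
    (by fun_prop) hx'
  exact this

theorem IsCompactMap.exists_nsmul {F : E3 → E4} {D E : ℝ} (hF : IsCompactMap F D E) (n : ℕ) :
    ∃ H, IsCompactMap H (n * D) (n * E) := by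
  induction n with
  | zero => exact ⟨_, by simpa using isCompactMap_const⟩
  | succ n ih =>
    obtain ⟨H, hH⟩ := ih
    obtain ⟨H', hH'⟩ := hH.exists_add hF
    exact ⟨H', by convert hH' using 1 <;> push_cast <;> ring⟩

/-! ### Radially symmetric maps -/

/-- The inclusion of `ℝ³` in `ℝ⁴` as the orthogonal complement of `pole`. -/
def incl : E3 →L[ℝ] E4 :=
  ∑ i : Fin 3, (EuclideanSpace.proj i : E3 →L[ℝ] ℝ).smulRight
    (EuclideanSpace.single i.castSucc (1 : ℝ))

theorem incl_apply (x : E3) : incl x = !₂[x 0, x 1, x 2, 0] := by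
  ext a
  fin_cases a <;> simp [incl, Fin.sum_univ_three]

/-- The radially symmetric map `x ↦ A(|x|²) x + b(|x|²) pole`. -/
def hedgehog (A b : ℝ → ℝ) (x : E3) : E4 := A (‖x‖ ^ 2) • incl x + b (‖x‖ ^ 2) • pole

theorem norm_sq_E3 (x : E3) : ‖x‖ ^ 2 = x 0 ^ 2 + x 1 ^ 2 + x 2 ^ 2 := by
  simp [EuclideanSpace.norm_sq_eq, Fin.sum_univ_three]

theorem hedgehog_apply (A b : ℝ → ℝ) (x : E3) : hedgehog A b x =
    !₂[A (‖x‖ ^ 2) * x 0, A (‖x‖ ^ 2) * x 1, A (‖x‖ ^ 2) * x 2, b (‖x‖ ^ 2)] := by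
  ext a
  fin_cases a <;> simp [hedgehog, incl_apply, pole]

theorem norm_hedgehog (A b : ℝ → ℝ) (x : E3) :
    ‖hedgehog A b x‖ ^ 2 = A (‖x‖ ^ 2) ^ 2 * ‖x‖ ^ 2 + b (‖x‖ ^ 2) ^ 2 := by
  rw [hedgehog_apply, norm_sq_E4]
  simp
  rw [norm_sq_E3 x]
  ring

theorem grad_hedgehog {A b : ℝ → ℝ} {A' b' : ℝ} {x : E3} (hA : HasDerivAt A A' (‖x‖ ^ 2))
    (hb : HasDerivAt b b' (‖x‖ ^ 2)) (i : Fin 3) : grad (hedgehog A b) x i =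
      A (‖x‖ ^ 2) • incl (EuclideanSpace.single i 1) + (2 * x i * A') • incl x +
        (2 * x i * b') • pole := by
  have hs : HasFDerivAt (fun y : E3 => ‖y‖ ^ 2) (2 • innerSL ℝ x) x :=
    (hasStrictFDerivAt_norm_sq x).hasFDerivAt
  have h1 := hA.comp_hasFDerivAt x hs
  have h2 := hb.comp_hasFDerivAt x hs
  have h3 := (h1.smul incl.hasFDerivAt).add (h2.smul_const pole)
  have h4 : HasFDerivAt (hedgehog A b) _ x := h3
  rw [grad, h4.fderiv]
  simp [EuclideanSpace.inner_single_right]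
  ring_nf

/-- The differential has singular values |a|, |a| in the tangential directions and |l| in the radial
one; the energy density is the sum of their squares and of the squares of their pairwise products.
Only l² is prescribed, so a signed radial stretch can be supplied without taking a square root. -/
theorem gradEnergy_hedgehog {A b : ℝ → ℝ} {A' b' : ℝ} {x : E3}
    (hA : HasDerivAt A A' (‖x‖ ^ 2)) (hb : HasDerivAt b b' (‖x‖ ^ 2)) {a l : ℝ}
    (ha : A (‖x‖ ^ 2) = a)
    (hl : l ^ 2 = a ^ 2 + (4 * a * A' + 4 * A' ^ 2 * ‖x‖ ^ 2 + 4 * b' ^ 2) * ‖x‖ ^ 2) :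
    gradEnergy (grad (hedgehog A b) x) =
      2 * a ^ 2 + l ^ 2 + a ^ 4 + 2 * a ^ 2 * l ^ 2 := by
  rw [hl, gradEnergy_eq]
  simp only [wedgeNormSq_eq, norm_sq_E4, grad_hedgehog hA hb, ha, incl_apply]
  simp [pole, norm_sq_E3 x]
  ring

theorem gradDet_hedgehog {A b : ℝ → ℝ} {A' b' : ℝ} {x : E3}
    (hA : HasDerivAt A A' (‖x‖ ^ 2)) (hb : HasDerivAt b b' (‖x‖ ^ 2)) :
    gradDet (hedgehog A b x) (grad (hedgehog A b) x) =
      A (‖x‖ ^ 2) ^ 2 * (2 * ‖x‖ ^ 2 * A (‖x‖ ^ 2) * b' - b (‖x‖ ^ 2) * A (‖x‖ ^ 2) -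
        2 * A' * b (‖x‖ ^ 2) * ‖x‖ ^ 2) := by
  simp only [gradDet_eq, grad_hedgehog hA hb, hedgehog_apply, incl_apply]
  generalize A (‖x‖ ^ 2) = a
  generalize b (‖x‖ ^ 2) = c
  simp [pole, norm_sq_E3 x]
  ring

/-! ### Stereographic projections with variable scale -/

/-- The map `x ↦ (2 q x, |x|² - q²) / (q² + |x|²)`, where `q` is a function of `|x|²`: the inverse
of a stereographic projection if `q` is constant. -/
def stereo (q : ℝ → ℝ) : E3 → E4 :=
  hedgehog (fun s => 2 * q s / (q s ^ 2 + s)) fun s => (s - q s ^ 2) / (q s ^ 2 + s)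

/-- The radial stretch of `stereo q`. -/
def stretch (q : ℝ → ℝ) (s : ℝ) : ℝ := 2 * (q s - 2 * s * deriv q s) / (q s ^ 2 + s)

theorem hasDerivAt_stereo_fst {q : ℝ → ℝ} (hq : ContDiff ℝ 1 q)
    (hpos : ∀ s, 0 ≤ s → 0 < q s ^ 2 + s) {s : ℝ} (hs : 0 ≤ s) :
    HasDerivAt (fun s => 2 * q s / (q s ^ 2 + s))
      ((2 * deriv q s * (q s ^ 2 + s) - 2 * q s * (2 * q s * deriv q s + 1)) / (q s ^ 2 + s) ^ 2)
      s := by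
  have h : HasDerivAt q (deriv q s) s := (hq.differentiable one_ne_zero s).hasDerivAt
  have h1 : HasDerivAt (fun s => q s ^ 2 + s) (2 * q s * deriv q s + 1) s := by
    refine ((h.pow 2).add (hasDerivAt_id s)).congr_deriv ?_
    simp
  exact (h.const_mul 2).div h1 (hpos s hs).ne'

theorem hasDerivAt_stereo_snd {q : ℝ → ℝ} (hq : ContDiff ℝ 1 q)
    (hpos : ∀ s, 0 ≤ s → 0 < q s ^ 2 + s) {s : ℝ} (hs : 0 ≤ s) :
    HasDerivAt (fun s => (s - q s ^ 2) / (q s ^ 2 + s))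
      (((1 - 2 * q s * deriv q s) * (q s ^ 2 + s) - (s - q s ^ 2) * (2 * q s * deriv q s + 1)) /
        (q s ^ 2 + s) ^ 2) s := by
  have h : HasDerivAt q (deriv q s) s := (hq.differentiable one_ne_zero s).hasDerivAt
  have h1 : HasDerivAt (fun s => q s ^ 2 + s) (2 * q s * deriv q s + 1) s := by
    refine ((h.pow 2).add (hasDerivAt_id s)).congr_deriv ?_
    simp
  have h2 : HasDerivAt (fun s => s - q s ^ 2) (1 - 2 * q s * deriv q s) s := by
    refine ((hasDerivAt_id s).sub (h.pow 2)).congr_deriv ?_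
    simp
  exact h2.div h1 (hpos s hs).ne'

theorem gradEnergy_stereo {q : ℝ → ℝ} (hq : ContDiff ℝ 1 q)
    (hpos : ∀ s, 0 ≤ s → 0 < q s ^ 2 + s) (x : E3) :
    gradEnergy (grad (stereo q) x) =
    2 * (2 * q (‖x‖ ^ 2) / (q (‖x‖ ^ 2) ^ 2 + ‖x‖ ^ 2)) ^ 2 + stretch q (‖x‖ ^ 2) ^ 2 +
      (2 * q (‖x‖ ^ 2) / (q (‖x‖ ^ 2) ^ 2 + ‖x‖ ^ 2)) ^ 4 +
      2 * (2 * q (‖x‖ ^ 2) / (q (‖x‖ ^ 2) ^ 2 + ‖x‖ ^ 2)) ^ 2 * stretch q (‖x‖ ^ 2) ^ 2 := by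
  have hs : 0 ≤ ‖x‖ ^ 2 := by positivity
  refine gradEnergy_hedgehog (hasDerivAt_stereo_fst hq hpos hs)
    (hasDerivAt_stereo_snd hq hpos hs) rfl ?_
  have := (hpos _ hs).ne'
  rw [stretch]
  generalize ‖x‖ ^ 2 = s at *
  field_simp
  ring

/-- The determinant is the product of the two tangential stretches and the signed radial one. -/
theorem gradDet_stereo {q : ℝ → ℝ} (hq : ContDiff ℝ 1 q)
    (hpos : ∀ s, 0 ≤ s → 0 < q s ^ 2 + s) (x : E3) :
    gradDet (stereo q x) (grad (stereo q) x) =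
    (2 * q (‖x‖ ^ 2) / (q (‖x‖ ^ 2) ^ 2 + ‖x‖ ^ 2)) ^ 2 * stretch q (‖x‖ ^ 2) := by
  have hs : 0 ≤ ‖x‖ ^ 2 := by positivity
  rw [stereo, gradDet_hedgehog (hasDerivAt_stereo_fst hq hpos hs)
    (hasDerivAt_stereo_snd hq hpos hs)]
  have := (hpos _ hs).ne'
  rw [stretch]
  generalize ‖x‖ ^ 2 = s at *
  field_simp
  ring

theorem contDiff_stereo {q : ℝ → ℝ} (hq : ContDiff ℝ 1 q)
    (hpos : ∀ s, 0 ≤ s → 0 < q s ^ 2 + s) : ContDiff ℝ 1 (stereo q) := by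
  have hn : ContDiff ℝ 1 fun x : E3 => ‖x‖ ^ 2 := contDiff_norm_sq ℝ
  have hqn : ContDiff ℝ 1 fun x : E3 => q (‖x‖ ^ 2) := hq.comp hn
  have hd : ∀ x : E3, q (‖x‖ ^ 2) ^ 2 + ‖x‖ ^ 2 ≠ 0 := fun x => (hpos _ (by positivity)).ne'
  have h1 := ((contDiff_const (c := (2 : ℝ))).mul hqn).div ((hqn.pow 2).add hn) hd
  have h2 := (hn.sub (hqn.pow 2)).div ((hqn.pow 2).add hn) hd
  exact (h1.smul incl.contDiff).add (h2.smul contDiff_const)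

theorem norm_stereo {q : ℝ → ℝ} (hpos : ∀ s, 0 ≤ s → 0 < q s ^ 2 + s) (x : E3) : ‖stereo q x‖ = 1 := by
  have hs : 0 ≤ ‖x‖ ^ 2 := by positivity
  have h := norm_hedgehog (fun s => 2 * q s / (q s ^ 2 + s))
    (fun s => (s - q s ^ 2) / (q s ^ 2 + s)) x
  have hp := (hpos _ hs).ne'
  rw [← sq_eq_sq₀ (norm_nonneg _) zero_le_one, stereo, h]
  generalize ‖x‖ ^ 2 = s at *
  field_simp
  ring

/-- Where q vanishes and x ≠ 0, the map takes the value `pole`; the radius |R| + 1 ensures both that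
‖x‖² ≥ R and that x ≠ 0. -/
theorem hasCompactSupport_stereo {q : ℝ → ℝ} {R : ℝ} (hR : ∀ s, R ≤ s → q s = 0) :
    HasCompactSupport fun x => stereo q x - pole := by
  refine HasCompactSupport.intro (isCompact_closedBall 0 (|R| + 1)) fun x hx => ?_
  have hx : |R| + 1 < ‖x‖ := by simpa using hx
  have h0 : q (‖x‖ ^ 2) = 0 := hR _ (by nlinarith [le_abs_self R, abs_nonneg R])
  have h1 : ‖x‖ ≠ 0 := (by positivity : (0 : ℝ) < |R| + 1).trans hx |>.ne'
  simp [stereo, hedgehog, h0, h1]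

theorem isCompactMap_stereo {q : ℝ → ℝ} (hq : ContDiff ℝ 1 q)
    (hpos : ∀ s, 0 ≤ s → 0 < q s ^ 2 + s) {R : ℝ} (hR : ∀ s, R ≤ s → q s = 0) :
    IsCompactMap (stereo q) (∫ x, gradDet (stereo q x) (grad (stereo q) x))
      (∫ x, gradEnergy (grad (stereo q) x)) :=
  ⟨contDiff_stereo hq hpos, norm_stereo hpos, hasCompactSupport_stereo hR, rfl, rfl⟩

/-! ### Radial integrals: limit energy and degree -/

/-- Integration of radial functions on `ℝ³`. -/
theorem integral_radial (f : ℝ → ℝ) :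
    ∫ x : E3, f ‖x‖ = 4 * Real.pi * ∫ r in Set.Ioi 0, r ^ 2 * f r := by
  rw [integral_fun_norm_addHaar, measureReal_def, EuclideanSpace.volume_ball_fin_three]
  have : (0 : ℝ) ≤ Real.pi * 4 / 3 := by positivity
  simp
  rw [ENNReal.toReal_ofReal this]
  ring

open Filter Topology

theorem tendsto_inv_half_add_sq : Tendsto (fun r : ℝ => (1 / 2 + r ^ 2)⁻¹) atTop (𝓝 0) :=
  tendsto_inv_atTop_zero.comp
    (tendsto_atTop_add_const_left _ _ (tendsto_pow_atTop two_ne_zero))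

/-- The radial integral for the energy of the optimally scaled stereographic projection. -/
theorem integral_Ioi_stereo :
    ∫ r in Set.Ioi (0 : ℝ), r ^ 2 * (6 / (1 / 2 + r ^ 2) ^ 2 + 12 / (1 / 2 + r ^ 2) ^ 4) =
      3 * √2 * Real.pi := by
  have h2 : √2 ^ 2 = 2 := Real.sq_sqrt zero_le_two
  -- An explicit antiderivative. Its rational part vanishes at 0 and at infinity, so only the
  -- arctangent contributes.
  have hderiv : ∀ r ∈ Set.Ici (0 : ℝ), HasDerivAt (fun r : ℝ => 6 * √2 * Real.arctan (√2 * r) +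
      (r / (1 / 2 + r ^ 2) ^ 2 - 2 * (r / (1 / 2 + r ^ 2) ^ 3)))
      (r ^ 2 * (6 / (1 / 2 + r ^ 2) ^ 2 + 12 / (1 / 2 + r ^ 2) ^ 4)) r := by
    intro r _
    have hw : 1 / 2 + r ^ 2 ≠ 0 := by positivity
    have d0 : HasDerivAt (fun r : ℝ => 1 / 2 + r ^ 2) (2 * r) r := by
      simpa using (hasDerivAt_pow 2 r).const_add (1 / 2)
    have d1 : HasDerivAt (fun r : ℝ => Real.arctan (√2 * r)) (1 / (1 + (√2 * r) ^ 2) * √2) r := by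
      simpa using ((hasDerivAt_id r).const_mul √2).arctan
    have d2 := (hasDerivAt_id r).fun_div (d0.fun_pow 2) (pow_ne_zero 2 hw)
    have d3 := (hasDerivAt_id r).fun_div (d0.fun_pow 3) (pow_ne_zero 3 hw)
    refine ((d1.const_mul (6 * √2)).add (d2.sub (d3.const_mul 2))).congr_deriv ?_
    have e : 6 * √2 * (1 / (1 + (√2 * r) ^ 2) * √2) = 6 / (1 / 2 + r ^ 2) := by
      rw [mul_pow, h2, eq_div_iff hw]
      have : 1 + 2 * r ^ 2 ≠ 0 := by positivity
      field_simp
      rw [h2]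
    rw [e]
    simp only [id]
    push_cast
    field_simp
    ring
  have hlim : Tendsto (fun r : ℝ => 6 * √2 * Real.arctan (√2 * r) +
      (r / (1 / 2 + r ^ 2) ^ 2 - 2 * (r / (1 / 2 + r ^ 2) ^ 3))) atTop
      (𝓝 (6 * √2 * (Real.pi / 2) + (0 - 2 * 0))) := by
    have hr : ∀ r : ℝ, r ≤ 1 / 2 + r ^ 2 := fun r => by nlinarith [sq_nonneg (r - 1 / 2)]
    have l1 : Tendsto (fun r : ℝ => Real.arctan (√2 * r)) atTop (𝓝 (Real.pi / 2)) :=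
      (tendsto_nhds_of_tendsto_nhdsWithin Real.tendsto_arctan_atTop).comp
        (tendsto_id.const_mul_atTop (by positivity))
    have l2 : Tendsto (fun r : ℝ => r / (1 / 2 + r ^ 2) ^ 2) atTop (𝓝 0) := by
      refine tendsto_of_tendsto_of_tendsto_of_le_of_le' tendsto_const_nhds
        tendsto_inv_half_add_sq ?_ ?_
      · filter_upwards [eventually_ge_atTop 0] with r h
        positivity
      · refine Eventually.of_forall fun r => ?_
        have : 0 < 1 / 2 + r ^ 2 := by positivity
        rw [div_le_iff₀ (by positivity)]
        field_simp
        linarith [hr r]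
    have l3 : Tendsto (fun r : ℝ => r / (1 / 2 + r ^ 2) ^ 3) atTop (𝓝 0) := by
      have := l2.mul tendsto_inv_half_add_sq
      rw [mul_zero] at this
      refine this.congr fun r => ?_
      have : 0 < 1 / 2 + r ^ 2 := by positivity
      field_simp
    exact (l1.const_mul _).add (l2.sub (l3.const_mul 2))
  rw [integral_Ioi_of_hasDerivAt_of_nonneg' hderiv (fun r _ => by positivity) hlim]
  simp
  ring

theorem integral_stereo_limit :
    ∫ x : E3, (6 / (1 / 2 + ‖x‖ ^ 2) ^ 2 + 12 / (1 / 2 + ‖x‖ ^ 2) ^ 4) =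
      12 * √2 * Real.pi ^ 2 := by
  rw [integral_radial fun r => 6 / (1 / 2 + r ^ 2) ^ 2 + 12 / (1 / 2 + r ^ 2) ^ 4,
    integral_Ioi_stereo]
  ring

/-- The degree of a compactly supported perturbation of a stereographic projection. -/
theorem integral_gradDet_stereo {q : ℝ → ℝ} (hq : ContDiff ℝ 1 q)
    (hpos : ∀ s, 0 ≤ s → 0 < q s ^ 2 + s) {R : ℝ} (hR : ∀ s, R ≤ s → q s = 0) {σ : ℝ}
    (hσ : Tendsto (fun r => Real.arctan (q (r ^ 2) / r)) (𝓝[>] 0) (𝓝 (σ * (Real.pi / 2)))) :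
    ∫ x, gradDet (stereo q x) (grad (stereo q) x) = σ * (2 * Real.pi ^ 2) := by
  set f : ℝ → ℝ := fun r => (2 * q (r ^ 2) / (q (r ^ 2) ^ 2 + r ^ 2)) ^ 2 * stretch q (r ^ 2)
  have hf : (fun x => gradDet (stereo q x) (grad (stereo q) x)) = fun x => f ‖x‖ :=
    funext (gradDet_stereo hq hpos)
  have hint : IntegrableOn (fun r => r ^ 2 * f r) (Set.Ioi 0) := by
    have h := (isCompactMap_stereo hq hpos hR).integrable_det
    rw [hf, integrable_fun_norm_addHaar] at h
    simpa using h
  -- With θ = 2 arctan(q/r), the map has polar angle θ from the pole and `stretch` is -θ'. The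
  -- integrand is therefore -sin²θ · θ', with antiderivative G = (sin θ cos θ - θ)/2.
  set G : ℝ → ℝ := fun r => r * q (r ^ 2) * (r ^ 2 - q (r ^ 2) ^ 2) / (q (r ^ 2) ^ 2 + r ^ 2) ^ 2 -
    Real.arctan (q (r ^ 2) / r) with hG
  have hpos0 : 0 < q 0 ^ 2 := by simpa using hpos 0 le_rfl
  have hderiv : ∀ r ∈ Set.Ioi (0 : ℝ), HasDerivAt G (r ^ 2 * f r) r := by
    intro r (hr : 0 < r)
    have hp := (hpos (r ^ 2) (by positivity)).ne'
    have d0 : HasDerivAt (fun r => q (r ^ 2)) (deriv q (r ^ 2) * (2 * r)) r := by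
      have h : HasDerivAt q (deriv q (r ^ 2)) (r ^ 2) :=
        (hq.differentiable one_ne_zero _).hasDerivAt
      refine (HasDerivAt.comp r h (h := fun r => r ^ 2) (hasDerivAt_pow 2 r)).congr_deriv ?_
      simp
    have d1 : HasDerivAt (fun r : ℝ => r ^ 2) (2 * r) r := by simpa using hasDerivAt_pow 2 r
    have d2 := (d0.fun_div (hasDerivAt_id r) hr.ne').arctan
    have d3 := (((hasDerivAt_id r).fun_mul d0).fun_mul (d1.fun_sub (d0.fun_pow 2))).fun_div
      (((d0.fun_pow 2).fun_add d1).fun_pow 2) (pow_ne_zero 2 hp)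
    refine (d3.sub d2).congr_deriv ?_
    have e : 1 + (q (r ^ 2) / id r) ^ 2 = (q (r ^ 2) ^ 2 + r ^ 2) / r ^ 2 := by
      simp only [id]
      field_simp
      ring
    rw [e]
    simp only [f, stretch, id]
    push_cast
    generalize q (r ^ 2) = Q at *
    generalize deriv q (r ^ 2) = Q' at *
    field_simp
    ring
  have hzero : Tendsto G (𝓝[>] 0) (𝓝 (0 - σ * (Real.pi / 2))) := by
    refine Tendsto.sub ?_ hσ
    have hc : ContinuousAt (fun r => r * q (r ^ 2) * (r ^ 2 - q (r ^ 2) ^ 2) /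
        (q (r ^ 2) ^ 2 + r ^ 2) ^ 2) 0 := by
      have := hq.continuous
      refine ContinuousAt.div (by fun_prop) (by fun_prop) ?_
      simpa using hpos0.ne'
    have := hc.tendsto
    simp only [zero_mul, zero_div] at this
    exact this.mono_left nhdsWithin_le_nhds
  have htop : Tendsto G atTop (𝓝 0) := by
    refine tendsto_const_nhds.congr' ?_
    filter_upwards [eventually_ge_atTop (|R| + 1)] with r hr
    have : q (r ^ 2) = 0 := hR _ (by nlinarith [le_abs_self R, abs_nonneg R])
    simp [hG, this]
  -- Division by zero makes G 0 = 0, which is not the limit at 0⁺; G is redefined there to be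
  -- continuous from the right.
  have hup : ∀ r ≠ 0, Function.update G 0 (0 - σ * (Real.pi / 2)) =ᶠ[𝓝 r] G := fun r hr => by
    filter_upwards [isOpen_ne.mem_nhds hr] with y hy using Function.update_of_ne hy _ _
  rw [hf, integral_radial, integral_Ioi_of_hasDerivAt_of_tendsto
    (f := Function.update G 0 (0 - σ * (Real.pi / 2))) (m := 0) ?_ ?_ hint ?_]
  · simp
    ring
  · rw [continuousWithinAt_update_same, Set.Ici_sdiff_left]
    exact hzero
  · exact fun r hr => (hderiv r hr).congr_of_eventuallyEq (hup r (ne_of_gt hr))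
  · refine htop.congr' ?_
    filter_upwards [eventually_gt_atTop 0] with r hr
    exact (Function.update_of_ne hr.ne' _ _).symm

/-! ### Cutoff and passage to the limit -/

/-- A `C¹` cutoff function, with a scale invariant bound for its derivative. -/
theorem exists_cutoff : ∃ (χ : ℝ → ℝ) (M : ℝ), ContDiff ℝ 1 χ ∧ (∀ t, |χ t| ≤ 1) ∧
    (∀ t ≤ 1, χ t = 1) ∧ (∀ t, 2 ≤ t → χ t = 0) ∧ (∀ t < 1, deriv χ t = 0) ∧
    ∀ t, |t * deriv χ t| ≤ M := by
  set χ : ℝ → ℝ := fun t => Real.smoothTransition (2 - t)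
  have hχ : ContDiff ℝ 1 χ :=
    (Real.smoothTransition.contDiff (n := 1)).comp (contDiff_const.sub contDiff_id)
  have h1 : ∀ t ≤ 1, χ t = 1 := fun t ht => Real.smoothTransition.one_of_one_le (by linarith)
  have h2 : ∀ t, 2 ≤ t → χ t = 0 := fun t ht => Real.smoothTransition.zero_of_nonpos (by linarith)
  have h1' : ∀ t < 1, deriv χ t = 0 := fun t ht => by
    have : χ =ᶠ[𝓝 t] fun _ => 1 := by
      filter_upwards [Iio_mem_nhds ht] with s hs using h1 s (le_of_lt hs)
    rw [this.deriv_eq, deriv_const]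
  have h2' : ∀ t, 2 < t → deriv χ t = 0 := fun t ht => by
    have : χ =ᶠ[𝓝 t] fun _ => 0 := by
      filter_upwards [Ioi_mem_nhds ht] with s hs using h2 s (le_of_lt hs)
    rw [this.deriv_eq, deriv_const]
  have hc : HasCompactSupport fun t => t * deriv χ t := by
    refine HasCompactSupport.intro (isCompact_Icc (a := 1) (b := 2)) fun t ht => ?_
    rw [Set.mem_Icc, not_and_or, not_le, not_le] at ht
    rcases ht with ht | ht
    · rw [h1' t ht, mul_zero]
    · rw [h2' t ht, mul_zero]
  obtain ⟨M, hM⟩ := hc.exists_bound_of_continuous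
    (continuous_id.mul (hχ.continuous_deriv le_rfl))
  refine ⟨χ, M, hχ, fun t => ?_, h1, h2, h1', hM⟩
  rw [abs_of_nonneg (Real.smoothTransition.nonneg _)]
  exact Real.smoothTransition.le_one _

/-- There are compactly supported maps of degree `1` and `-1` with energy arbitrarily close to
the least energy of a dilated stereographic projection. -/
theorem exists_isCompactMap {σ : ℝ} (hσ : σ = 1 ∨ σ = -1) {ε : ℝ} (hε : 0 < ε) :
    ∃ F E, IsCompactMap F (σ * (2 * Real.pi ^ 2)) E ∧ E < 12 * √2 * Real.pi ^ 2 + ε := by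
  obtain ⟨χ, M, hχ, hχ1, hone, hzero, hone', hM⟩ := exists_cutoff
  have hM0 : 0 ≤ M := (abs_nonneg _).trans (hM 0)
  -- The size 1/√2 minimizes 12π²|μ| + 6π²/|μ|, and the sign σ fixes the orientation.
  set μ : ℝ := σ * (√2)⁻¹ with hμ
  have hμ2 : μ ^ 2 = 1 / 2 := by
    rw [hμ, mul_pow, inv_pow, Real.sq_sqrt zero_le_two]
    rcases hσ with rfl | rfl <;> norm_num
  have hμ1 : |μ| ≤ 1 := by
    rw [← sq_le_one_iff_abs_le_one, hμ2]
    norm_num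
  set q : ℕ → ℝ → ℝ := fun n s => μ * χ (s / (n + 1)) with hqdef
  have hn : ∀ n : ℕ, (0 : ℝ) < n + 1 := fun n => by positivity
  have hq : ∀ n, ContDiff ℝ 1 (q n) := fun n =>
    contDiff_const.mul (hχ.comp (contDiff_id.div_const _))
  have hq' : ∀ n s, s * deriv (q n) s = μ * (s / (n + 1) * deriv χ (s / (n + 1))) := by
    intro n s
    have h : HasDerivAt χ (deriv χ (s / (n + 1))) (s / (n + 1)) :=
      (hχ.differentiable one_ne_zero _).hasDerivAt
    have h' : HasDerivAt (q n) (μ * (deriv χ (s / (n + 1)) * (1 / (n + 1)))) s :=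
      (h.comp s ((hasDerivAt_id s).div_const _)).const_mul μ
    rw [h'.deriv]
    ring
  -- A lower bound for the denominator that is uniform in n: for s ≤ 1 the cutoff is inactive and q²
  -- = 1/2, while for s ≥ 1 the term s suffices alone.
  have hlow : ∀ n s, 0 ≤ s → (1 + s) / 2 ≤ q n s ^ 2 + s := by
    intro n s hs
    rcases le_total s 1 with h | h
    · have : q n s = μ := by
        have : s / (n + 1) ≤ 1 := by
          rw [div_le_one (hn n)]
          linarith [(Nat.cast_nonneg n : (0 : ℝ) ≤ n)]
        simp [hqdef, hone _ this]
      rw [this, hμ2]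
      linarith
    · nlinarith [sq_nonneg (q n s)]
  have hpos : ∀ n s, 0 ≤ s → 0 < q n s ^ 2 + s := fun n s hs =>
    lt_of_lt_of_le (by positivity) (hlow n s hs)
  have hR : ∀ (n : ℕ) (s : ℝ), 2 * ((n : ℝ) + 1) ≤ s → q n s = 0 := by
    intro n s hs
    have : χ (s / (n + 1)) = 0 := hzero _ (by rwa [le_div_iff₀ (hn n)])
    simp [hqdef, this]
  have hmap := fun n => isCompactMap_stereo (hq n) (hpos n) (hR n)
  have hdet : ∀ n, ∫ x, gradDet (stereo (q n) x) (grad (stereo (q n)) x) =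
      σ * (2 * Real.pi ^ 2) := by
    intro n
    refine integral_gradDet_stereo (hq n) (hpos n) (hR n) ?_
    have hlim : Tendsto (fun r => Real.arctan (μ / r)) (𝓝[>] 0) (𝓝 (σ * (Real.pi / 2))) := by
      have l : Tendsto (fun r : ℝ => Real.arctan ((√2)⁻¹ * r⁻¹)) (𝓝[>] 0) (𝓝 (Real.pi / 2)) :=
        (tendsto_nhds_of_tendsto_nhdsWithin Real.tendsto_arctan_atTop).comp
          (tendsto_inv_nhdsGT_zero.const_mul_atTop (by positivity))
      rcases hσ with rfl | rfl
      · simpa [hμ, div_eq_mul_inv] using l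
      · simpa [hμ, div_eq_mul_inv, Real.arctan_neg] using l.neg
    refine hlim.congr' ?_
    filter_upwards [Ioo_mem_nhdsGT (zero_lt_one (α := ℝ))] with r hr
    have : r ^ 2 / (n + 1) ≤ 1 := by
      rw [div_le_one (hn n)]
      nlinarith [hr.1, hr.2, (Nat.cast_nonneg n : (0 : ℝ) ≤ n)]
    simp [hqdef, hone _ this]
  -- The numerators of both stretches are at most 2(1 + 2M), because s q'(s) = μ t χ'(t) with t =
  -- s/(n + 1) is bounded independently of n; `hlow` costs another factor 2.
  set K : ℝ := 4 * (1 + 2 * M) with hK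
  have hK4 : 4 ≤ K := by linarith
  have hA : ∀ n s, 0 ≤ s → |2 * q n s / (q n s ^ 2 + s)| ≤ K / (1 + s) := by
    intro n s hs
    have hqb : |q n s| ≤ 1 := by
      rw [hqdef, abs_mul]
      exact mul_le_one₀ hμ1 (abs_nonneg _) (hχ1 _)
    rw [abs_div, abs_of_pos (hpos n s hs), div_le_div_iff₀ (hpos n s hs) (by positivity), abs_mul,
      abs_two]
    have := hlow n s hs
    nlinarith
  have hL : ∀ n s, 0 ≤ s → |stretch (q n) s| ≤ K / (1 + s) := by
    intro n s hs
    have hb : |2 * (q n s - 2 * s * deriv (q n) s)| ≤ K / 2 := by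
      have e : 2 * (q n s - 2 * s * deriv (q n) s) =
          μ * (2 * (χ (s / (n + 1)) - 2 * (s / (n + 1) * deriv χ (s / (n + 1))))) := by
        rw [mul_assoc 2 s, hq']
        ring
      have b1 := abs_le.1 (hχ1 (s / (n + 1)))
      have b2 := abs_le.1 (hM (s / (n + 1)))
      rw [e, abs_mul]
      refine (mul_le_mul_of_nonneg_right hμ1 (abs_nonneg _)).trans ?_
      rw [one_mul, abs_le]
      constructor <;> linarith
    rw [stretch, abs_div, abs_of_pos (hpos n s hs),
      div_le_div_iff₀ (hpos n s hs) (by positivity)]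
    have := hlow n s hs
    nlinarith
  -- Decay like ‖x‖⁻⁴ is integrable since 4 > 3; the real exponent is the form in which
  -- integrability is available.
  have hbound : ∀ n (x : E3), ‖gradEnergy (grad (stereo (q n)) x)‖ ≤
      (3 * K ^ 2 + 3 * K ^ 4) * (1 + ‖x‖ ^ 2) ^ (-(4 : ℝ) / 2) := by
    intro n x
    have hs : 0 ≤ ‖x‖ ^ 2 := by positivity
    have e : (1 + ‖x‖ ^ 2) ^ (-(4 : ℝ) / 2) = ((1 + ‖x‖ ^ 2) ^ 2)⁻¹ := by
      rw [show (-(4 : ℝ) / 2) = -(2 : ℕ) by norm_num, Real.rpow_neg (by positivity),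
        Real.rpow_natCast]
    rw [e, Real.norm_eq_abs, abs_of_nonneg (gradEnergy_nonneg _),
      gradEnergy_stereo (hq n) (hpos n)]
    have h1 := hA n _ hs
    have h2 := hL n _ hs
    generalize 2 * q n (‖x‖ ^ 2) / (q n (‖x‖ ^ 2) ^ 2 + ‖x‖ ^ 2) = a at *
    generalize stretch (q n) (‖x‖ ^ 2) = l at *
    generalize ‖x‖ ^ 2 = s at *
    have ha : a ^ 2 ≤ (K / (1 + s)) ^ 2 := by
      rw [← sq_abs a]
      gcongr
    have hl : l ^ 2 ≤ (K / (1 + s)) ^ 2 := by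
      rw [← sq_abs l]
      gcongr
    calc 2 * a ^ 2 + l ^ 2 + a ^ 4 + 2 * a ^ 2 * l ^ 2
        = 2 * a ^ 2 + l ^ 2 + (a ^ 2) ^ 2 + 2 * (a ^ 2 * l ^ 2) := by ring
      _ ≤ 2 * (K / (1 + s)) ^ 2 + (K / (1 + s)) ^ 2 + ((K / (1 + s)) ^ 2) ^ 2 +
          2 * ((K / (1 + s)) ^ 2 * (K / (1 + s)) ^ 2) := by gcongr
      _ = 3 * K ^ 2 * ((1 + s) ^ 2)⁻¹ + 3 * K ^ 4 * ((1 + s) ^ 4)⁻¹ := by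
          field_simp
          ring
      _ ≤ 3 * K ^ 2 * ((1 + s) ^ 2)⁻¹ + 3 * K ^ 4 * ((1 + s) ^ 2)⁻¹ := by
          gcongr
          · linarith
          · norm_num
      _ = (3 * K ^ 2 + 3 * K ^ 4) * ((1 + s) ^ 2)⁻¹ := by ring
  have hint : Integrable fun x : E3 =>
      (3 * K ^ 2 + 3 * K ^ 4) * (1 + ‖x‖ ^ 2) ^ (-(4 : ℝ) / 2) :=
    (integrable_rpow_neg_one_add_norm_sq (by simp; norm_num)).const_mul _
  have hptw : ∀ x : E3, Tendsto (fun n => gradEnergy (grad (stereo (q n)) x)) atTop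
      (𝓝 (6 / (1 / 2 + ‖x‖ ^ 2) ^ 2 + 12 / (1 / 2 + ‖x‖ ^ 2) ^ 4)) := by
    intro x
    -- For fixed x the sequence is eventually constant: once n + 1 > ‖x‖², the cutoff is 1 near the
    -- point of evaluation, so both stretches are 2μ/(1/2 + ‖x‖²).
    refine tendsto_const_nhds.congr' ?_
    obtain ⟨N, hN⟩ := exists_nat_gt (‖x‖ ^ 2)
    filter_upwards [eventually_ge_atTop N] with n hnN
    have hlt : ‖x‖ ^ 2 / (n + 1) < 1 := by
      rw [div_lt_one (hn n)]
      have : (N : ℝ) ≤ n := by exact_mod_cast hnN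
      linarith
    have hqx : q n (‖x‖ ^ 2) = μ := by simp [hqdef, hone _ hlt.le]
    have hst : stretch (q n) (‖x‖ ^ 2) = 2 * μ / (1 / 2 + ‖x‖ ^ 2) := by
      rw [stretch, mul_assoc 2 (‖x‖ ^ 2), hq', hone' _ hlt, hqx, hμ2]
      simp
    rw [gradEnergy_stereo (hq n) (hpos n), hst, hqx, hμ2, div_pow, div_pow]
    have e2 : (2 * μ) ^ 2 = 2 := by rw [mul_pow, hμ2]; norm_num
    have e4 : (2 * μ) ^ 4 = 4 := by
      rw [show (2 * μ) ^ 4 = ((2 * μ) ^ 2) ^ 2 by ring, e2]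
      norm_num
    have : (0 : ℝ) < 1 / 2 + ‖x‖ ^ 2 := by positivity
    rw [e2, e4]
    field_simp
    ring
  have hlimit := tendsto_integral_of_dominated_convergence _
    (fun n => (continuous_gradEnergy (hmap n).contDiff).aestronglyMeasurable) hint
    (fun n => Eventually.of_forall (hbound n)) (Eventually.of_forall hptw)
  rw [integral_stereo_limit] at hlimit
  obtain ⟨n, hnε⟩ := (hlimit.eventually_lt_const (lt_add_of_pos_right _ hε)).exists
  exact ⟨_, _, hdet n ▸ hmap n, hnε⟩

/-! ### The upper bound for every degree -/

theorem minEnergy_le (k : ℤ) :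
    minEnergy k ≤ ENNReal.ofReal (12 * √2 * |(k : ℝ)| * Real.pi ^ 2) := by
  obtain ⟨σ, hσ, hk⟩ : ∃ σ : ℝ, (σ = 1 ∨ σ = -1) ∧ (k : ℝ) = k.natAbs * σ := by
    rcases Int.natAbs_eq k with h | h
    · exact ⟨1, Or.inl rfl, by rw [mul_one, ← Int.cast_natCast, ← h]⟩
    · exact ⟨-1, Or.inr rfl, by rw [mul_neg_one, ← Int.cast_natCast, ← Int.cast_neg, ← h]⟩
  have hkabs : |(k : ℝ)| = k.natAbs := by rw [Nat.cast_natAbs, Int.cast_abs]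
  refine ENNReal.le_of_forall_pos_le_add fun ε hε _ => ?_
  -- The error is shared among |k| copies; the +1 covers k = 0.
  have hε' : (0 : ℝ) < ε / (k.natAbs + 1) := by positivity
  obtain ⟨F, E, hF, hE⟩ := exists_isCompactMap hσ hε'
  obtain ⟨H, hH⟩ := hF.exists_nsmul k.natAbs
  obtain ⟨φ, hφ, hd, he⟩ := hH.exists_mem_X
  have hdeg : degree φ = (k : ℝ) := by
    rw [hd, hk]
    have := Real.pi_pos
    field_simp
  calc minEnergy k ≤ energy φ := iInf₂_le φ ⟨hφ, hdeg⟩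
    _ = ENNReal.ofReal (k.natAbs * E) := he
    _ ≤ ENNReal.ofReal (12 * √2 * |(k : ℝ)| * Real.pi ^ 2 + ε) := by
        refine ENNReal.ofReal_le_ofReal ?_
        rw [hkabs]
        have h1 : (k.natAbs : ℝ) * E ≤
            k.natAbs * (12 * √2 * Real.pi ^ 2 + ε / (k.natAbs + 1)) := by gcongr
        have h2 : (k.natAbs : ℝ) * (ε / (k.natAbs + 1)) ≤ ε := by
          rw [← mul_div_assoc, div_le_iff₀ (by positivity)]
          nlinarith [ε.coe_nonneg]
        linarith
    _ = _ := by
        rw [ENNReal.ofReal_add (by positivity) ε.coe_nonneg, ENNReal.ofReal_coe_nnreal]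

end Skyrme
end

theorem proposition2 (k : ℤ) :
    ENNReal.ofReal (12 * |(k : ℝ)| * Real.pi ^ 2) ≤ Skyrme.minEnergy k ∧
      Skyrme.minEnergy k ≤ ENNReal.ofReal (12 * Real.sqrt 2 * |(k : ℝ)| * Real.pi ^ 2) := by
  refine ⟨le_iInf₂ fun φ hφ => ?_, Skyrme.minEnergy_le k⟩
  rw [← hφ.2]
  exact Skyrme.energy_ge φ
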